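/- Let $V$ and $V_*$ be complex vector spaces of countably infinite dimension with a non-degenerate bilinear pairing $V_*\otimes V\to\mathbb C$, and regard $V_*$ as a subspace of the full dual $V^*$ through this pairing. Let $\mathfrak g^M=\{X\in\operatorname{End}(V) : X^*(V_*)\subseteq V_*\}$ be the associated Mackey Lie algebra, acting on $V$ naturally, on $V^*$ by $X\cdot f=-f\circ X$, and on tensor products by the Leibniz rule. For $m,n\ge 0$ let $W=(V^*)^{\otimes m}\otimes V^{\otimes n}$. For a binary word $\mathbf r=(r_1,\dots,r_m)\in\{0,1\}^m$ put $|\mathbf r|=\sum_i r_i$ and $V^{\mathbf r}=V^{r_1}\otimes\cdots\otimes V^{r_m}\subseteq (V^*)^{\otimes m}$, where $V^0=V_*$ and $V^1=V^*$. For $0\le k\le m$ set $$W^k=\sum_{|\mathbf r|\le k}V^{\mathbf r}\otimes V^{\otimes n}\subseteq W .$$ (So $W^k$ is spanned by the tensor products in which at most $k$ of the $m$ factors are $V^*$ and the remaining ones are $V_*$.) A chain $M^0\subseteq M^1\subseteq\cdots\subseteq M^l=M$ of submodules of a module $M$ is called an essential filtration of $M$ if for all $p<q<r$ the submodule $M^q/M^p$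 of $M^r/M^p$ is essential, i.e. meets every non-zero submodule of $M^r/M^p$ non-trivially. **Proposition.** The chain $W^0\subseteq W^1\subseteq\cdots\subseteq W^m=W$ is an essential filtration of $W$ in the category of $\mathfrak g^M$-modules, and so is the chain $0=W^{-1}\subseteq W^0\subseteq W^1\subseteq\cdots\subseteq W^m=W$. -/

import Mathlib

open scoped TensorProduct

/-! ### Tensor powers of Lie algebra representations -/

section PiTensorLie

set_option linter.unusedSectionVars false

variable {R L ι : Type*} [CommRing R] [LieRing L] [LieAlgebra R L] [Fintype ι] [DecidableEq ι]
  {M : ι → Type*} [∀ i, AddCommGroup (M i)] [∀ i, Module R (M i)]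
  [∀ i, LieRingModule L (M i)] [∀ i, LieModule R L (M i)]

/-- The element `x` of the Lie algebra acting on the `i`-th tensor factor only. -/
noncomputable def piTensorActAt (x : L) (i : ι) : Module.End R (⨂[R] i, M i) :=
  PiTensorProduct.map
    (Function.update (fun _ => LinearMap.id) i (LieModule.toEnd R L (M i) x))

theorem piTensorActAt_tprod (x : L) (i : ι) (m : ∀ i, M i) :
    piTensorActAt x i (PiTensorProduct.tprod R m) =
      PiTensorProduct.tprod R (Function.update m i ⁅x, m i⁆) := by
  unfold piTensorActAt
  rw [PiTensorProduct.map_tprod]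
  congr 1
  funext j
  by_cases h : j = i
  · subst h; simp
  · simp [Function.update_of_ne h]

theorem piTensorActAt_comm (x y : L) {i j : ι} (h : i ≠ j) (t : ⨂[R] i, M i) :
    piTensorActAt x i (piTensorActAt y j t) = piTensorActAt y j (piTensorActAt x i t) := by
  induction t using PiTensorProduct.induction_on with
  | smul_tprod r m =>
    simp only [map_smul, piTensorActAt_tprod, Function.update_of_ne h,
      Function.update_of_ne h.symm, Function.update_comm h]
  | add a b ha hb => simp only [map_add, ha, hb]

theorem piTensorActAt_lie (x y : L) (i : ι) (t : ⨂[R] i, M i) :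
    piTensorActAt ⁅x, y⁆ i t =
      piTensorActAt x i (piTensorActAt y i t) - piTensorActAt y i (piTensorActAt x i t) := by
  induction t using PiTensorProduct.induction_on with
  | smul_tprod r m =>
    simp only [map_smul, piTensorActAt_tprod, Function.update_self, Function.update_idem,
      lie_lie, MultilinearMap.map_update_sub, smul_sub]
  | add a b ha hb => simp only [map_add, ha, hb]; abel

/-- The Lie algebra acts on a finite tensor product of modules by the Leibniz rule. -/
noncomputable def piTensorAct (x : L) : Module.End R (⨂[R] i, M i) :=
  ∑ i, piTensorActAt x i

noncomputable instance PiTensorProduct.instLieRingModule : LieRingModule L (⨂[R] i, M i) where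
  bracket x t := piTensorAct x t
  add_lie x y t := by
    simp only [piTensorAct, piTensorActAt, map_add, PiTensorProduct.map_update_add,
      Finset.sum_add_distrib, LinearMap.add_apply]
  lie_add x := map_add _
  leibniz_lie x y t := by
    simp only [piTensorAct, LinearMap.sum_apply, map_sum]
    rw [← sub_eq_iff_eq_add, Finset.sum_comm, ← Finset.sum_sub_distrib]
    refine Finset.sum_congr rfl fun i _ => ?_
    rw [← Finset.sum_sub_distrib, Finset.sum_eq_single i]
    · exact (piTensorActAt_lie x y i t).symm
    · intro j _ hj
      rw [piTensorActAt_comm x y hj.symm, sub_self]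
    · simp

theorem PiTensorProduct.lie_tprod (x : L) (m : ∀ i, M i) :
    ⁅x, PiTensorProduct.tprod R m⁆ =
      ∑ i, PiTensorProduct.tprod R (Function.update m i ⁅x, m i⁆) := by
  change piTensorAct x _ = _
  simp only [piTensorAct, LinearMap.sum_apply, piTensorActAt_tprod]

instance PiTensorProduct.instLieModule : LieModule R L (⨂[R] i, M i) where
  smul_lie c x t := by
    change piTensorAct (c • x) t = c • piTensorAct x t
    simp only [piTensorAct, piTensorActAt, map_smul, PiTensorProduct.map_update_smul,
      Finset.smul_sum, LinearMap.sum_apply, LinearMap.smul_apply]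
  lie_smul c x t := map_smul (piTensorAct x) c t

end PiTensorLie

/-! ### Tensor powers -/

section TensorPow

variable (K U : Type*) [Field K] [AddCommGroup U] [Module K U] (n : ℕ)

/-- The tensor power `U^{⊗ n}`. -/
def TensorPow : Type _ := ⨂[K] _ : Fin n, U

noncomputable instance : AddCommGroup (TensorPow K U n) :=
  inferInstanceAs (AddCommGroup (⨂[K] _ : Fin n, U))

noncomputable instance : Module K (TensorPow K U n) :=
  inferInstanceAs (Module K (⨂[K] _ : Fin n, U))

variable {L : Type*} [LieRing L] [LieAlgebra K L] [LieRingModule L U] [LieModule K L U]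

noncomputable instance : LieRingModule L (TensorPow K U n) :=
  inferInstanceAs (LieRingModule L (⨂[K] _ : Fin n, U))

instance : LieModule K L (TensorPow K U n) :=
  inferInstanceAs (LieModule K L (⨂[K] _ : Fin n, U))

variable {U n}

/-- The simple tensor `u_1 ⊗ ⋯ ⊗ u_n` in `U^{⊗ n}`. -/
noncomputable def simpleTensor (u : Fin n → U) : TensorPow K U n :=
  PiTensorProduct.tprod K u

theorem lie_simpleTensor (x : L) (u : Fin n → U) :
    ⁅x, simpleTensor K u⁆ = ∑ i, simpleTensor K (Function.update u i ⁅x, u i⁆) :=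
  PiTensorProduct.lie_tprod x u

end TensorPow

/-! ### Essential filtrations -/

section Essential

variable {R L M : Type*} [CommRing R] [LieRing L] [LieAlgebra R L] [AddCommGroup M] [Module R M]
  [LieRingModule L M] [LieModule R L M]

/-- A submodule is essential if it meets every non-zero submodule non-trivially. -/
def LieSubmodule.IsEssential (E : LieSubmodule R L M) : Prop :=
  ∀ N : LieSubmodule R L M, N ≠ ⊥ → E ⊓ N ≠ ⊥

/-- The module `C / A`, for submodules `A ⊆ C` of `M`. -/
abbrev LieSubmodule.Subquotient (A C : LieSubmodule R L M) : Type _ :=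
  C ⧸ A.comap C.incl

/-- The submodule `B / A` of `C / A`, for submodules `A ⊆ B ⊆ C` of `M`. -/
def LieSubmodule.inSubquotient (A B C : LieSubmodule R L M) :
    LieSubmodule R L (LieSubmodule.Subquotient A C) :=
  (B.comap C.incl).map (LieSubmodule.Quotient.mk' (A.comap C.incl))

/-- A chain `F 0 ⊆ F 1 ⊆ ⋯ ⊆ F n = M` of submodules is an essential filtration of `M` if
`F q / F p` is essential in `F r / F p` for all `p < q < r`. -/
structure IsEssentialFiltration {n : ℕ} (F : Fin (n + 1) → LieSubmodule R L M) : Prop where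
  monotone : Monotone F
  last_eq_top : F (Fin.last n) = ⊤
  essential : ∀ p q r : Fin (n + 1), p < q → q < r →
    (LieSubmodule.inSubquotient (F p) (F q) (F r)).IsEssential

end Essential

/-! ### The Mackey Lie algebra of a pairing and the filtration -/

section Mackey

/-- `End(V)` is a Lie algebra under the commutator. -/
instance Module.End.instLieRingCommutator {R M : Type*} [CommRing R] [AddCommGroup M]
    [Module R M] : LieRing (Module.End R M) :=
  LieRing.ofAssociativeRing

variable {K V Vs : Type*} [Field K] [AddCommGroup V] [Module K V] [AddCommGroup Vs] [Module K Vs]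

/-- The Mackey Lie algebra of a pairing `B : Vs × V → K`: all endomorphisms of `V` whose dual maps
the image of `Vs` in `V^*` into itself. -/
def mackeyLieAlgebra (B : Vs →ₗ[K] Module.Dual K V) : LieSubalgebra K (Module.End K V) where
  carrier := {X | ∀ f ∈ LinearMap.range B, X.dualMap f ∈ LinearMap.range B}
  zero_mem' f _ := by
    have : (0 : Module.End K V).dualMap f = 0 := by ext; simp
    rw [this]; exact zero_mem _
  add_mem' {X Y} hX hY f hf := by
    have : (X + Y).dualMap f = X.dualMap f + Y.dualMap f := by ext; simp
    rw [this]; exact add_mem (hX f hf) (hY f hf)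
  smul_mem' c X hX f hf := by
    have : (c • X).dualMap f = c • X.dualMap f := by ext; simp
    rw [this]; exact Submodule.smul_mem _ c (hX f hf)
  lie_mem' {X Y} hX hY f hf := by
    have : (⁅X, Y⁆ : Module.End K V).dualMap f =
        Y.dualMap (X.dualMap f) - X.dualMap (Y.dualMap f) := by
      ext v; simp [LieRing.of_associative_ring_bracket]
    rw [this]; exact sub_mem (hY _ (hX f hf)) (hX _ (hY f hf))

/-- The image `V_*` of `Vs` in `V^*`, a submodule of `V^*` over the Mackey Lie algebra. -/
def smallDual (B : Vs →ₗ[K] Module.Dual K V) :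
    LieSubmodule K (mackeyLieAlgebra B) (Module.Dual K V) where
  toSubmodule := LinearMap.range B
  lie_mem {x f} hf := by
    have h : ⁅x, f⁆ = - (x : Module.End K V).dualMap f := by ext v; rfl
    change ⁅x, f⁆ ∈ LinearMap.range B
    rw [h]; exact neg_mem (x.2 f hf)

/-- The module `(V^*)^{⊗ m} ⊗ V^{⊗ n}`. -/
abbrev MixedTensor (K V : Type*) [Field K] [AddCommGroup V] [Module K V] (m n : ℕ) : Type _ :=
  TensorPow K (Module.Dual K V) m ⊗[K] TensorPow K V n

/-- The action on `(V^*)^{⊗ m} ⊗ V^{⊗ n}` is given by the Leibniz rule. -/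
theorem lie_mixedTensor (B : Vs →ₗ[K] Module.Dual K V) {m n : ℕ} (g : mackeyLieAlgebra B)
    (y : Fin m → Module.Dual K V) (x : Fin n → V) :
    ⁅g, (simpleTensor K y ⊗ₜ[K] simpleTensor K x : MixedTensor K V m n)⁆ =
      ∑ i, simpleTensor K (Function.update y i (-(g : Module.End K V).dualMap (y i))) ⊗ₜ[K]
          simpleTensor K x +
        ∑ j, simpleTensor K y ⊗ₜ[K]
          simpleTensor K (Function.update x j ((g : Module.End K V) (x j))) := by
  refine (TensorProduct.LieModule.lie_tmul_right (R := K) (g : Module.End K V)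
    (simpleTensor K y) (simpleTensor K x)).trans ?_
  rw [lie_simpleTensor, lie_simpleTensor, TensorProduct.sum_tmul, TensorProduct.tmul_sum]
  rfl

/-- The tensor factor `V^0 = V_*` or `V^1 = V^*`. -/
def letterModule (B : Vs →ₗ[K] Module.Dual K V) (a : Fin 2) :
    LieSubmodule K (mackeyLieAlgebra B) (Module.Dual K V) :=
  if a = 0 then smallDual B else ⊤

/-- For a binary word `r`, the submodule `V^{r_1} ⊗ ⋯ ⊗ V^{r_m} ⊗ V^{⊗ n}` of
`(V^*)^{⊗ m} ⊗ V^{⊗ n}`, spanned by the simple tensors with `i`-th tensorand in `V^{r_i}`. -/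
noncomputable def wordModule (B : Vs →ₗ[K] Module.Dual K V) {m : ℕ} (n : ℕ) (r : Fin m → Fin 2) :
    LieSubmodule K (mackeyLieAlgebra B) (MixedTensor K V m n) where
  toSubmodule := Submodule.span K
    {t | ∃ (y : Fin m → Module.Dual K V) (x : Fin n → V), (∀ i, y i ∈ letterModule B (r i)) ∧
      t = simpleTensor K y ⊗ₜ[K] simpleTensor K x}
  lie_mem {g t} ht := by
    change ⁅g, t⁆ ∈ Submodule.span K _
    change t ∈ Submodule.span K _ at ht
    induction ht using Submodule.span_induction with
    | zero => rw [lie_zero]; exact zero_mem _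
    | add a b _ _ ha hb => rw [lie_add]; exact add_mem ha hb
    | smul c a _ ha => rw [lie_smul]; exact Submodule.smul_mem _ c ha
    | mem t ht =>
      obtain ⟨y, x, hy, rfl⟩ := ht
      rw [lie_mixedTensor]
      refine add_mem (sum_mem fun i _ => Submodule.subset_span ⟨_, _, fun j => ?_, rfl⟩)
        (sum_mem fun i _ => Submodule.subset_span ⟨_, _, hy, rfl⟩)
      by_cases h : j = i
      · subst h
        rw [Function.update_self]
        exact LieSubmodule.lie_mem _ (hy j)
      · rw [Function.update_of_ne h]
        exact hy j

/-- `W^k`, the sum of the `V^r ⊗ V^{⊗ n}` over the binary words `r` of length `m` with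
`r_1 + ⋯ + r_m ≤ k`. -/
noncomputable def mixedFiltration (B : Vs →ₗ[K] Module.Dual K V) (m n k : ℕ) :
    LieSubmodule K (mackeyLieAlgebra B) (MixedTensor K V m n) :=
  ⨆ (r : Fin m → Fin 2) (_ : ∑ i, (r i : ℕ) ≤ k), wordModule B n r

end Mackey

/-! ### Slotwise linear maps on mixed tensors -/

/-! Choose a linear projection `P` of V^* onto V_*; it need not commute with the Lie algebra.
Expanding (1 - P) + P = 1 in every dual slot splits a tensor t into components t_T, one for each set
T of slots, with 1 - P applied in the slots of T and `P` in the others. Then W^k consists of the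
tensors with t_T = 0 whenever |T| > k (`mem_mixedFiltration_iff`). Call the largest |T| with t_T ≠ 0
the degree of t. It suffices to show that a tensor of degree k + 1 can be moved by some Lie algebra
element to degree exactly k: repeating this inside a submodule reaches every smaller degree.

The element is a rank one operator w ↦ f(w) v, with f in V_* and v in V. Let t involve only a
finite-dimensional, `P`-stable space D of functionals and a finite-dimensional space G of vectors.
Since V_* is infinite-dimensional, f can vanish on G and lie outside D; the operator then acts on
the dual slots only, by h ↦ -h(v) f. If moreover v is annihilated by P(D), it replaces a (1 -
P)-slot by f and kills the `P`-slots, so the degree drops (`wordProj_lie_mackeyRankOne`). As f is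
new to t, the slot where it appears can be isolated, and letting v vary shows that not all
components of degree k vanish (`exists_lie_wordProj_ne_zero`). -/

section SlotMap

variable {K V : Type*} [Field K] [AddCommGroup V] [Module K V] {m n : ℕ}

/-- The endomorphism `A_1 ⊗ ⋯ ⊗ A_m ⊗ id` of `(V^*)^{⊗ m} ⊗ V^{⊗ n}`, as a multilinear function
of `A`. -/
noncomputable def slotMap (K V : Type*) [Field K] [AddCommGroup V] [Module K V] (m n : ℕ) :
    MultilinearMap K (fun _ : Fin m => Module.End K (Module.Dual K V))
      (Module.End K (MixedTensor K V m n)) :=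
  (LinearMap.rTensorHom (TensorPow K V n) :
      Module.End K (TensorPow K (Module.Dual K V) m) →ₗ[K] _).compMultilinearMap
    (PiTensorProduct.mapMultilinear K (fun _ : Fin m => Module.Dual K V)
      (fun _ => Module.Dual K V))

theorem slotMap_tmul (A : Fin m → Module.End K (Module.Dual K V))
    (y : Fin m → Module.Dual K V) (x : Fin n → V) :
    slotMap K V m n A (simpleTensor K y ⊗ₜ[K] simpleTensor K x) =
      simpleTensor K (fun i => A i (y i)) ⊗ₜ[K] simpleTensor K x :=
  congrArg (· ⊗ₜ[K] simpleTensor K x) (PiTensorProduct.map_tprod A y)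

/-- The span of the simple tensors with dual factors in `D` and vector factors in `G`. -/
noncomputable def supportedTensors (m n : ℕ) (D : Submodule K (Module.Dual K V)) (G : Submodule K V) :
    Submodule K (MixedTensor K V m n) :=
  Submodule.span K {t | ∃ (y : Fin m → Module.Dual K V) (x : Fin n → V),
    (∀ i, y i ∈ D) ∧ (∀ j, x j ∈ G) ∧ t = simpleTensor K y ⊗ₜ[K] simpleTensor K x}

theorem supportedTensors_mono {D D' : Submodule K (Module.Dual K V)} {G G' : Submodule K V}
    (hD : D ≤ D') (hG : G ≤ G') : supportedTensors m n D G ≤ supportedTensors m n D' G' := by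
  refine Submodule.span_mono ?_
  rintro t ⟨y, x, hy, hx, rfl⟩
  exact ⟨y, x, fun i => hD (hy i), fun j => hG (hx j), rfl⟩

theorem supportedTensors_top :
    supportedTensors m n (⊤ : Submodule K (Module.Dual K V)) (⊤ : Submodule K V) = ⊤ := by
  rw [eq_top_iff]
  rintro t -
  induction t using TensorProduct.induction_on with
  | zero => exact zero_mem _
  | add a b ha hb => exact add_mem ha hb
  | tmul a b =>
    have ha : a ∈ Submodule.span K (Set.range (simpleTensor K (U := Module.Dual K V) (n := m))) :=
      (PiTensorProduct.span_tprod_eq_top (R := K) (s := fun _ : Fin m => Module.Dual K V)).ge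
        Submodule.mem_top
    have hb : b ∈ Submodule.span K (Set.range (simpleTensor K (U := V) (n := n))) :=
      (PiTensorProduct.span_tprod_eq_top (R := K) (s := fun _ : Fin n => V)).ge Submodule.mem_top
    induction ha using Submodule.span_induction with
    | zero => rw [TensorProduct.zero_tmul]; exact zero_mem _
    | add p q _ _ hp hq => rw [TensorProduct.add_tmul]; exact add_mem hp hq
    | smul c p _ hp => rw [← TensorProduct.smul_tmul']; exact Submodule.smul_mem _ c hp
    | mem p hp =>
      obtain ⟨y, rfl⟩ := hp
      induction hb using Submodule.span_induction with
      | zero => rw [TensorProduct.tmul_zero]; exact zero_mem _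
      | add p q _ _ hp hq => rw [TensorProduct.tmul_add]; exact add_mem hp hq
      | smul c p _ hp => rw [TensorProduct.tmul_smul]; exact Submodule.smul_mem _ c hp
      | mem p hp =>
        obtain ⟨x, rfl⟩ := hp
        exact Submodule.subset_span ⟨y, x, fun _ => trivial, fun _ => trivial, rfl⟩

theorem exists_mem_supportedTensors (t : MixedTensor K V m n) :
    ∃ (D : Submodule K (Module.Dual K V)) (G : Submodule K V),
      FiniteDimensional K D ∧ FiniteDimensional K G ∧ t ∈ supportedTensors m n D G := by
  have ht : t ∈ supportedTensors m n ⊤ ⊤ := supportedTensors_top.ge Submodule.mem_top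
  change t ∈ Submodule.span K _ at ht
  induction ht using Submodule.span_induction with
  | zero => exact ⟨⊥, ⊥, inferInstance, inferInstance, zero_mem _⟩
  | add a b _ _ ha hb =>
    obtain ⟨D, G, _, _, ha⟩ := ha
    obtain ⟨D', G', _, _, hb⟩ := hb
    exact ⟨D ⊔ D', G ⊔ G', inferInstance, inferInstance,
      add_mem (supportedTensors_mono le_sup_left le_sup_left ha)
        (supportedTensors_mono le_sup_right le_sup_right hb)⟩
  | smul c a _ ha =>
    obtain ⟨D, G, hD, hG, ha⟩ := ha
    exact ⟨D, G, hD, hG, Submodule.smul_mem _ c ha⟩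
  | mem t ht =>
    obtain ⟨y, x, -, -, rfl⟩ := ht
    exact ⟨Submodule.span K (Set.range y), Submodule.span K (Set.range x),
      FiniteDimensional.span_of_finite K (Set.finite_range y),
      FiniteDimensional.span_of_finite K (Set.finite_range x),
      Submodule.subset_span ⟨y, x, fun i => Submodule.subset_span ⟨i, rfl⟩,
        fun j => Submodule.subset_span ⟨j, rfl⟩, rfl⟩⟩

theorem linearMap_eq_of_mem_supportedTensors {M : Type*} [AddCommGroup M] [Module K M]
    {D : Submodule K (Module.Dual K V)} {G : Submodule K V} {f g : MixedTensor K V m n →ₗ[K] M}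
    (h : ∀ (y : Fin m → Module.Dual K V) (x : Fin n → V), (∀ i, y i ∈ D) → (∀ j, x j ∈ G) →
      f (simpleTensor K y ⊗ₜ[K] simpleTensor K x) = g (simpleTensor K y ⊗ₜ[K] simpleTensor K x))
    {t : MixedTensor K V m n} (ht : t ∈ supportedTensors m n D G) : f t = g t := by
  refine LinearMap.eqOn_span (R := K) ?_ ht
  rintro t ⟨y, x, hy, hx, rfl⟩
  exact h y x hy hx

theorem mixedTensor_hom_ext {M : Type*} [AddCommGroup M] [Module K M]
    {f g : MixedTensor K V m n →ₗ[K] M}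
    (h : ∀ (y : Fin m → Module.Dual K V) (x : Fin n → V),
      f (simpleTensor K y ⊗ₜ[K] simpleTensor K x) =
        g (simpleTensor K y ⊗ₜ[K] simpleTensor K x)) : f = g :=
  LinearMap.ext fun t => linearMap_eq_of_mem_supportedTensors (fun y x _ _ => h y x)
    (supportedTensors_top.ge (Submodule.mem_top (x := t)))

/-- This allows an operator on V^* to be exchanged for one that agrees with it only on the
functionals occurring in the tensor. -/
theorem slotMap_congr {D : Submodule K (Module.Dual K V)} {G : Submodule K V}
    {t : MixedTensor K V m n} (ht : t ∈ supportedTensors m n D G)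
    {A A' : Fin m → Module.End K (Module.Dual K V)} (h : ∀ i, ∀ d ∈ D, A i d = A' i d) :
    slotMap K V m n A t = slotMap K V m n A' t := by
  refine linearMap_eq_of_mem_supportedTensors (fun y x hy _ => ?_) ht
  rw [slotMap_tmul, slotMap_tmul]
  simp only [h _ _ (hy _)]

theorem slotMap_mul (A A' : Fin m → Module.End K (Module.Dual K V)) :
    slotMap K V m n (A * A') = slotMap K V m n A * slotMap K V m n A' := by
  refine mixedTensor_hom_ext fun y x => ?_
  rw [Module.End.mul_apply, slotMap_tmul, slotMap_tmul, slotMap_tmul]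
  rfl

theorem slotMap_one : slotMap K V m n 1 = 1 :=
  mixedTensor_hom_ext fun y x => by rw [slotMap_tmul]; rfl

theorem slotMap_mul_apply (A A' : Fin m → Module.End K (Module.Dual K V))
    (t : MixedTensor K V m n) :
    slotMap K V m n (A * A') t = slotMap K V m n A (slotMap K V m n A' t) := by
  rw [slotMap_mul]; rfl

theorem slotMap_eq_zero {D : Submodule K (Module.Dual K V)} {G : Submodule K V}
    {t : MixedTensor K V m n} (ht : t ∈ supportedTensors m n D G)
    {A : Fin m → Module.End K (Module.Dual K V)} (i : Fin m) (h : ∀ d ∈ D, A i d = 0) :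
    slotMap K V m n A t = 0 := by
  rw [slotMap_congr ht (A' := Function.update A i 0), MultilinearMap.map_update_zero,
    LinearMap.zero_apply]
  intro j d hd
  by_cases hj : j = i
  · subst hj; simp [h d hd]
  · rw [Function.update_of_ne hj]

/-- An element of the Mackey Lie algebra killing all the vector factors of a tensor acts on it
through the dual factors only. -/
theorem lie_eq_sum_slotMap {Vs : Type*} [AddCommGroup Vs] [Module K Vs]
    {B : Vs →ₗ[K] Module.Dual K V} {D : Submodule K (Module.Dual K V)} {G : Submodule K V}
    {t : MixedTensor K V m n} (ht : t ∈ supportedTensors m n D G) (g : mackeyLieAlgebra B)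
    (hg : ∀ v ∈ G, (g : Module.End K V) v = 0) :
    ⁅g, t⁆ = ∑ i, slotMap K V m n
      (Function.update 1 i (-(g : Module.End K V).dualMap)) t := by
  have := linearMap_eq_of_mem_supportedTensors
    (f := LieModule.toEnd K (mackeyLieAlgebra B) (MixedTensor K V m n) g)
    (g := ∑ i, slotMap K V m n (Function.update 1 i (-(g : Module.End K V).dualMap)))
    (fun y x _ hx => ?_) ht
  · simpa using this
  · rw [LieModule.toEnd_apply_apply, lie_mixedTensor, LinearMap.sum_apply]
    have hzero : ∀ j, simpleTensor K (Function.update x j ((g : Module.End K V) (x j))) = 0 := by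
      intro j
      rw [hg _ (hx j)]
      exact (PiTensorProduct.tprod K).map_update_zero x j
    simp only [hzero, TensorProduct.tmul_zero, Finset.sum_const_zero, add_zero]
    refine Finset.sum_congr rfl fun i _ => ?_
    rw [slotMap_tmul]
    congr 2
    funext j
    by_cases hj : j = i
    · subst hj; simp
    · simp [Function.update_of_ne hj]

end SlotMap

/-! ### A criterion for essential filtrations -/

section EssentialCriterion

variable {R L M : Type*} [CommRing R] [LieRing L] [LieAlgebra R L] [AddCommGroup M] [Module R M]
  [LieRingModule L M] [LieModule R L M]

theorem LieSubmodule.isEssential_inSubquotient {A E C : LieSubmodule R L M}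
    (h : ∀ N : LieSubmodule R L M, ∀ x ∈ N, x ∉ A → ∃ y ∈ N, y ∈ E ∧ y ∉ A) :
    (LieSubmodule.inSubquotient A E C).IsEssential := by
  intro N hN
  obtain ⟨z, hzN, hz⟩ := Submodule.exists_mem_ne_zero_of_ne_bot
    (fun h => hN ((LieSubmodule.toSubmodule_eq_bot N).1 h))
  obtain ⟨c, rfl⟩ := LieSubmodule.Quotient.surjective_mk' _ z
  have hcA : (c : M) ∉ A := fun hc => hz ((LieSubmodule.Quotient.mk_eq_zero _).2 hc)
  -- The hypothesis concerns submodules of M, so N is pulled back to C and then pushed into M.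
  obtain ⟨y, hyN, hyE, hyA⟩ := h
    ((N.comap (LieSubmodule.Quotient.mk' (A.comap C.incl))).map C.incl) c
    ((LieSubmodule.mem_map _).2 ⟨c, hzN, rfl⟩) hcA
  obtain ⟨d, hd, rfl⟩ := (LieSubmodule.mem_map _).1 hyN
  intro hbot
  have hmem : LieSubmodule.Quotient.mk' (A.comap C.incl) d ∈
      LieSubmodule.inSubquotient A E C ⊓ N := ⟨(LieSubmodule.mem_map _).2 ⟨d, hyE, rfl⟩, hd⟩
  rw [hbot, LieSubmodule.mem_bot] at hmem
  exact hyA ((LieSubmodule.Quotient.mk_eq_zero (A.comap C.incl)).1 hmem)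

/-- An element found in `F (p + 1)` lies in every `F q` with q > p, so single steps control all
triples p < q < r. -/
theorem isEssentialFiltration_of_exists_mem_succ {n : ℕ} {F : ℕ → LieSubmodule R L M}
    (hmono : Monotone F) (htop : F n = ⊤)
    (h : ∀ p, ∀ N : LieSubmodule R L M, ∀ x ∈ N, x ∉ F p → ∃ y ∈ N, y ∈ F (p + 1) ∧ y ∉ F p) :
    IsEssentialFiltration (fun k : Fin (n + 1) => F k) where
  monotone _ _ hij := hmono hij
  last_eq_top := htop
  essential p q r hpq hqr := by
    refine LieSubmodule.isEssential_inSubquotient fun N x hx hxp => ?_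
    obtain ⟨y, hyN, hy, hyp⟩ := h p N x hx hxp
    exact ⟨y, hyN, hmono (Nat.succ_le_of_lt hpq) hy, hyp⟩

end EssentialCriterion

/-! ### The filtration in terms of a splitting of the dual space -/

section WordProj

variable {K V Vs : Type*} [Field K] [AddCommGroup V] [Module K V] [AddCommGroup Vs] [Module K Vs]
  {m n : ℕ}

/-- The endomorphism of `(V^*)^{⊗ m} ⊗ V^{⊗ n}` applying `1 - P` to the dual factors in `T` and
`P` to the other ones. -/
noncomputable def wordProj (n : ℕ) (P : Module.End K (Module.Dual K V)) (T : Finset (Fin m)) :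
    Module.End K (MixedTensor K V m n) :=
  slotMap K V m n (T.piecewise (fun _ => 1 - P) (fun _ => P))

theorem sum_wordProj (P : Module.End K (Module.Dual K V)) :
    ∑ T : Finset (Fin m), wordProj n P T = 1 := by
  unfold wordProj
  rw [← MultilinearMap.map_add_univ, ← slotMap_one]
  congr 1
  funext i
  exact sub_add_cancel 1 P

theorem eq_zero_of_wordProj_eq_zero (P : Module.End K (Module.Dual K V))
    {t : MixedTensor K V m n} (h : ∀ T : Finset (Fin m), wordProj n P T t = 0) : t = 0 := by
  have := LinearMap.congr_fun (sum_wordProj (m := m) (n := n) P) t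
  rw [LinearMap.sum_apply, Finset.sum_eq_zero fun T _ => h T] at this
  exact this.symm

variable {B : Vs →ₗ[K] Module.Dual K V} {P : Module.End K (Module.Dual K V)}

theorem wordProj_mem_wordModule (hP : ∀ h, P h ∈ LinearMap.range B) (T : Finset (Fin m))
    (t : MixedTensor K V m n) :
    wordProj n P T t ∈ wordModule B n (fun i => if i ∈ T then 1 else 0) := by
  have ht : t ∈ supportedTensors m n ⊤ ⊤ := supportedTensors_top.ge Submodule.mem_top
  change t ∈ Submodule.span K _ at ht
  induction ht using Submodule.span_induction with
  | zero => rw [map_zero]; exact zero_mem _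
  | add a b _ _ ha hb => rw [map_add]; exact add_mem ha hb
  | smul c a _ ha => rw [map_smul]; exact Submodule.smul_mem _ c ha
  | mem t ht =>
    obtain ⟨y, x, -, -, rfl⟩ := ht
    rw [wordProj, slotMap_tmul]
    refine Submodule.subset_span ⟨_, _, fun i => ?_, rfl⟩
    by_cases hi : i ∈ T
    · simp [hi, letterModule]
    · simp only [hi, if_false, letterModule, if_true, Finset.piecewise_eq_of_notMem _ _ _ hi]
      exact hP (y i)

theorem wordProj_eq_zero_of_mem_wordModule (hP : ∀ h ∈ LinearMap.range B, P h = h)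
    {T : Finset (Fin m)} {r : Fin m → Fin 2} {i : Fin m} (hi : i ∈ T) (hr : r i = 0)
    {t : MixedTensor K V m n} (ht : t ∈ wordModule B n r) : wordProj n P T t = 0 := by
  change t ∈ Submodule.span K _ at ht
  induction ht using Submodule.span_induction with
  | zero => rw [map_zero]
  | add a b _ _ ha hb => rw [map_add, ha, hb, add_zero]
  | smul c a _ ha => rw [map_smul, ha, smul_zero]
  | mem t ht =>
    obtain ⟨y, x, hy, rfl⟩ := ht
    have hyi : y i ∈ LinearMap.range B := by
      have := hy i
      rw [hr, letterModule, if_pos rfl] at this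
      exact this
    rw [wordProj, slotMap_tmul]
    have h0 : T.piecewise (fun _ => 1 - P) (fun _ => P) i (y i) = 0 := by
      simp [hi, hP _ hyi]
    have : simpleTensor K (fun i => T.piecewise (fun _ => 1 - P) (fun _ => P) i (y i)) = 0 :=
      (PiTensorProduct.tprod K).map_coord_zero i h0
    rw [this, TensorProduct.zero_tmul]

/-- If |T| > k, each word r with sum at most k has r_i = 0 for some i in T, and there 1 - P
annihilates V_*. Conversely, t is the sum of its components, and the T-component lies in the word
module of the indicator of T. -/
theorem mem_mixedFiltration_iff (hP : ∀ h, P h ∈ LinearMap.range B)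
    (hP' : ∀ h ∈ LinearMap.range B, P h = h) {k : ℕ} {t : MixedTensor K V m n} :
    t ∈ mixedFiltration B m n k ↔ ∀ T : Finset (Fin m), k < T.card → wordProj n P T t = 0 := by
  constructor
  · intro ht T hT
    rw [← LieSubmodule.mem_toSubmodule] at ht
    have hle : (mixedFiltration B m n k : Submodule K (MixedTensor K V m n)) ≤
        LinearMap.ker (wordProj n P T) := by
      simp only [mixedFiltration, LieSubmodule.iSup_toSubmodule]
      refine iSup₂_le fun r hr t ht => ?_
      obtain ⟨i, hi, hri⟩ : ∃ i ∈ T, r i = 0 := by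
        by_contra! hne
        have h1 : ∑ i ∈ T, 1 ≤ ∑ i ∈ T, (r i : ℕ) := Finset.sum_le_sum fun i hi =>
          Nat.one_le_iff_ne_zero.2 fun h => hne i hi (Fin.ext h)
        have h2 : ∑ i ∈ T, (r i : ℕ) ≤ ∑ i, (r i : ℕ) :=
          Finset.sum_le_sum_of_subset (Finset.subset_univ T)
        rw [← Finset.card_eq_sum_ones] at h1
        omega
      exact wordProj_eq_zero_of_mem_wordModule hP' hi hri ht
    exact hle ht
  · intro h
    have ht : t = ∑ T : Finset (Fin m), wordProj n P T t := by
      rw [← LinearMap.sum_apply, sum_wordProj]; rfl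
    rw [ht]
    refine sum_mem fun T _ => ?_
    by_cases hT : k < T.card
    · rw [h T hT]; exact zero_mem _
    · have hle : wordModule B n (fun i => if i ∈ T then 1 else 0) ≤ mixedFiltration B m n k := by
        refine le_iSup₂_of_le (f := fun (r : Fin m → Fin 2) (_ : ∑ i, (r i : ℕ) ≤ k) =>
          wordModule B n r) _ ?_ le_rfl
        have : ∀ i, (((if i ∈ T then 1 else 0 : Fin 2)) : ℕ) = if i ∈ T then 1 else 0 := by
          intro i; split_ifs <;> rfl
        simp only [this, Finset.sum_ite_mem, Finset.univ_inter, Finset.sum_const, smul_eq_mul,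
          mul_one]
        omega
      exact hle (wordProj_mem_wordModule hP T t)

/-- The filtration by the `W^k` preceded by `0`, with indices shifted by one. -/
noncomputable def shiftedFiltration (B : Vs →ₗ[K] Module.Dual K V) (m n : ℕ) :
    ℕ → LieSubmodule K (mackeyLieAlgebra B) (MixedTensor K V m n)
  | 0 => ⊥
  | k + 1 => mixedFiltration B m n k

theorem mem_shiftedFiltration_iff (hP : ∀ h, P h ∈ LinearMap.range B)
    (hP' : ∀ h ∈ LinearMap.range B, P h = h) {k : ℕ} {t : MixedTensor K V m n} :
    t ∈ shiftedFiltration B m n k ↔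
      ∀ T : Finset (Fin m), k ≤ T.card → wordProj n P T t = 0 := by
  cases k with
  | zero =>
    refine (LieSubmodule.mem_bot t).trans ⟨fun h T _ => by rw [h, map_zero], fun h => ?_⟩
    exact eq_zero_of_wordProj_eq_zero P fun T => h T T.card.zero_le
  | succ k => exact mem_mixedFiltration_iff hP hP'

end WordProj

/-! ### Vectors and functionals -/

section Functionals

variable {K V Vs : Type*} [Field K] [AddCommGroup V] [Module K V] [AddCommGroup Vs] [Module K Vs]

theorem exists_projection_onto (S : Submodule K V) :
    ∃ P : Module.End K V, (∀ h, P h ∈ S) ∧ ∀ h ∈ S, P h = h := by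
  obtain ⟨g, hg⟩ := LinearMap.exists_leftInverse_of_injective S.subtype S.ker_subtype
  refine ⟨S.subtype ∘ₗ g, fun h => (g h).2, fun h hh => ?_⟩
  exact congrArg Subtype.val (LinearMap.congr_fun hg ⟨h, hh⟩)

/-- An endomorphism of a finite-dimensional space of functionals is a sum of operators of rank one
given by evaluations at vectors. -/
theorem exists_eq_sum_eval_smul {D : Type*} [AddCommGroup D] [Module K D] [FiniteDimensional K D]
    {e : D →ₗ[K] V →ₗ[K] K} (he : Function.Injective e) (Q : Module.End K D) :
    ∃ (s : ℕ) (v : Fin s → V) (c : Fin s → D),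
      (∀ j d, Q d = 0 → e d (v j) = 0) ∧ ∀ d, Q d = ∑ j, e d (v j) • c j := by
  let b := Module.finBasis K D
  -- As `e` is injective and D is finite-dimensional, every functional on D is evaluation at some
  -- vector of V; this is applied to the coordinates of Q.
  choose v hv using fun j => (LinearMap.flip_surjective_iff₁.2 he) (b.coord j ∘ₗ Q)
  have hv' : ∀ j d, e d (v j) = b.repr (Q d) j := fun j d => LinearMap.congr_fun (hv j) d
  refine ⟨_, v, b, fun j d h0 => ?_, fun d => ?_⟩
  · simp [hv', h0]
  · simp only [hv', b.sum_repr]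

/-- The functionals in `Vs` vanishing on G have finite codimension, hence form an
infinite-dimensional space, which cannot embed in D. -/
theorem exists_vanishing_notMem (hVs : ¬ FiniteDimensional K Vs) {B : Vs →ₗ[K] Module.Dual K V}
    (hB : Function.Injective B) (D : Submodule K (Module.Dual K V)) [FiniteDimensional K D]
    (G : Submodule K V) [FiniteDimensional K G] :
    ∃ f : Vs, (∀ v ∈ G, B f v = 0) ∧ B f ∉ D := by
  by_contra! h
  refine hVs ?_
  let R : Vs →ₗ[K] Module.Dual K G := G.subtype.dualMap ∘ₗ B
  have hR : ∀ f ∈ LinearMap.ker R, B f ∈ D := fun f hf =>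
    h f fun v hv => LinearMap.congr_fun hf (⟨v, hv⟩ : G)
  have : FiniteDimensional K (LinearMap.ker R) :=
    FiniteDimensional.of_injective (B.restrict hR) fun a b hab =>
      Subtype.ext (hB (congrArg (fun d : D => (d : Module.Dual K V)) hab))
  have : FiniteDimensional K (Vs ⧸ LinearMap.ker R) :=
    Module.Finite.equiv R.quotKerEquivRange.symm
  exact Module.Finite.of_submodule_quotient (LinearMap.ker R)

/-- The rank one operator `w ↦ f(w) v`, for `f` in `V_*` and `v` in `V`. -/
noncomputable def mackeyRankOne (B : Vs →ₗ[K] Module.Dual K V) (f : Vs) (v : V) :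
    mackeyLieAlgebra B :=
  ⟨(B f).smulRight v, fun g _ => ⟨g v • f, by ext w; simp [mul_comm]⟩⟩

theorem dualMap_mackeyRankOne (B : Vs →ₗ[K] Module.Dual K V) (f : Vs) (v : V)
    (h : Module.Dual K V) :
    (mackeyRankOne B f v : Module.End K V).dualMap h = h v • B f := by
  ext w; simp [mackeyRankOne, mul_comm]

end Functionals

/-! ### Lowering the degree by rank one operators -/

section Main

variable {K V Vs : Type*} [Field K] [AddCommGroup V] [Module K V] [AddCommGroup Vs] [Module K Vs]
  {m n : ℕ}

/-- Every tensor is supported on a finite-dimensional space of functionals stable under a given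
idempotent endomorphism. -/
theorem exists_stable_mem_supportedTensors {P : Module.End K (Module.Dual K V)}
    (hPP : ∀ h, P (P h) = P h) (t : MixedTensor K V m n) :
    ∃ (D : Submodule K (Module.Dual K V)) (G : Submodule K V),
      FiniteDimensional K D ∧ FiniteDimensional K G ∧ (∀ d ∈ D, P d ∈ D) ∧
        t ∈ supportedTensors m n D G := by
  obtain ⟨D, G, _, _, ht⟩ := exists_mem_supportedTensors t
  refine ⟨D ⊔ D.map P, G, inferInstance, inferInstance, fun d hd => ?_,
    supportedTensors_mono le_sup_left le_rfl ht⟩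
  obtain ⟨a, ha, b, hb, rfl⟩ := Submodule.mem_sup.1 hd
  obtain ⟨c, hc, rfl⟩ := hb
  refine Submodule.mem_sup_right ⟨a + c, add_mem ha hc, ?_⟩
  rw [map_add, map_add, hPP]

theorem wordProj_slotMap_update (P A : Module.End K (Module.Dual K V)) (T : Finset (Fin m))
    (i : Fin m) (t : MixedTensor K V m n) :
    wordProj n P T (slotMap K V m n (Function.update 1 i A) t) =
      slotMap K V m n (Function.update (T.piecewise (fun _ => 1 - P) (fun _ => P)) i
        (T.piecewise (fun _ => 1 - P) (fun _ => P) i * A)) t := by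
  rw [wordProj, ← slotMap_mul_apply]
  congr 2
  funext j
  by_cases hj : j = i
  · subst hj; simp
  · simp [Function.update_of_ne hj]

theorem slotMap_update_wordProj (P A : Module.End K (Module.Dual K V)) (T : Finset (Fin m))
    (i : Fin m) (t : MixedTensor K V m n) :
    slotMap K V m n (Function.update 1 i A) (wordProj n P T t) =
      slotMap K V m n (Function.update (T.piecewise (fun _ => 1 - P) (fun _ => P)) i
        (A * T.piecewise (fun _ => 1 - P) (fun _ => P) i)) t := by
  rw [wordProj, ← slotMap_mul_apply]
  congr 2
  funext j
  by_cases hj : j = i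
  · subst hj; simp
  · simp [Function.update_of_ne hj]

/-- On D, h(v) = ((1 - P)h)(v), so only the (1 - P)-part of a slot contributes, and it becomes a
multiple of `B f`, which `P` fixes. A T-component therefore arises only by acting in a slot i
outside T on the component of T ∪ {i}. -/
theorem wordProj_lie_mackeyRankOne {B : Vs →ₗ[K] Module.Dual K V}
    {P : Module.End K (Module.Dual K V)} (hP' : ∀ h ∈ LinearMap.range B, P h = h)
    {D : Submodule K (Module.Dual K V)} {G : Submodule K V}
    {t : MixedTensor K V m n} (ht : t ∈ supportedTensors m n D G) {f : Vs}
    (hf : ∀ w ∈ G, B f w = 0) {v : V} (hv : ∀ d ∈ D, P d v = 0) (T : Finset (Fin m)) :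
    wordProj n P T ⁅mackeyRankOne B f v, t⁆ =
      ∑ i ∈ Tᶜ, slotMap K V m n
        (Function.update 1 i (-(mackeyRankOne B f v : Module.End K V).dualMap))
          (wordProj n P (insert i T) t) := by
  have hPf : P (B f) = B f := hP' _ ⟨f, rfl⟩
  rw [lie_eq_sum_slotMap ht _ fun w hw => by simp [mackeyRankOne, hf w hw], map_sum,
    ← Finset.sum_subset (Finset.subset_univ Tᶜ)]
  · refine Finset.sum_congr rfl fun i hi => ?_
    rw [Finset.mem_compl] at hi
    rw [wordProj_slotMap_update, slotMap_update_wordProj]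
    refine slotMap_congr ht fun j d hd => ?_
    by_cases hj : j = i
    · subst hj
      simp only [Function.update_self, Finset.piecewise_eq_of_notMem _ _ _ hi,
        Finset.piecewise_eq_of_mem _ _ _ (Finset.mem_insert_self j T), Module.End.mul_apply,
        LinearMap.neg_apply, dualMap_mackeyRankOne, map_neg, map_smul, hPf]
      rw [LinearMap.sub_apply, LinearMap.sub_apply, hv d hd, sub_zero]
      rfl
    · simp only [Function.update_of_ne hj]
      by_cases hjT : j ∈ T
      · rw [Finset.piecewise_eq_of_mem _ _ _ hjT,
          Finset.piecewise_eq_of_mem _ _ _ (Finset.mem_insert_of_mem hjT)]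
      · rw [Finset.piecewise_eq_of_notMem _ _ _ hjT,
          Finset.piecewise_eq_of_notMem _ _ _ (by simp [hj, hjT])]
  · intro i _ hi
    rw [Finset.mem_compl, not_not] at hi
    rw [wordProj_slotMap_update]
    refine slotMap_eq_zero ht i fun d _ => ?_
    simp only [Function.update_self, Finset.piecewise_eq_of_mem _ _ _ hi, Module.End.mul_apply,
        LinearMap.neg_apply, dualMap_mackeyRankOne, map_neg, map_smul]
    rw [LinearMap.sub_apply, hPf]
    simp

/-- The Lie algebra moves a tensor with a component of top degree `k` one step down the
filtration, but not further. -/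
theorem exists_lie_wordProj_ne_zero (hVs : ¬ FiniteDimensional K Vs)
    {B : Vs →ₗ[K] Module.Dual K V} (hB : Function.Injective B)
    {P : Module.End K (Module.Dual K V)} (hP : ∀ h, P h ∈ LinearMap.range B)
    (hP' : ∀ h ∈ LinearMap.range B, P h = h) {k : ℕ} {t : MixedTensor K V m n}
    (ht : ∀ T : Finset (Fin m), k + 1 < T.card → wordProj n P T t = 0)
    {S : Finset (Fin m)} (hS : S.card = k + 1) (hSt : wordProj n P S t ≠ 0) :
    ∃ g : mackeyLieAlgebra B,
      (∀ T : Finset (Fin m), k < T.card → wordProj n P T ⁅g, t⁆ = 0) ∧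
        ∃ T : Finset (Fin m), T.card = k ∧ wordProj n P T ⁅g, t⁆ ≠ 0 := by
  have hPP : ∀ h, P (P h) = P h := fun h => hP' _ (hP h)
  obtain ⟨D, G, _, _, hPD, htD⟩ := exists_stable_mem_supportedTensors hPP t
  obtain ⟨f, hfG, hfD⟩ := exists_vanishing_notMem hVs hB D G
  obtain ⟨φ, hφf, hφD⟩ := Submodule.exists_le_ker_of_notMem hfD
  have hQD : ∀ d ∈ D, (1 - P) d ∈ D := fun d hd => sub_mem hd (hPD d hd)
  have hQP : ∀ h, (1 - P) (P h) = 0 := fun h => by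
    rw [LinearMap.sub_apply, hPP]; exact sub_self _
  obtain ⟨s, v, c, hv, hc⟩ := exists_eq_sum_eval_smul (K := K) (V := V) (D := D) (e := D.subtype)
    D.injective_subtype ((1 - P).restrict hQD)
  -- P d lies in the kernel of 1 - P, hence is annihilated by every v_j.
  have hvP : ∀ j, ∀ d ∈ D, P d (v j) = 0 := fun j d hd =>
    hv j ⟨P d, hPD d hd⟩ (Subtype.ext (hQP d))
  have hc' : ∀ d ∈ D, (1 - P) d = ∑ j, d (v j) • (c j : Module.Dual K V) := by
    intro d hd
    have := congrArg D.subtype (hc ⟨d, hd⟩)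
    rw [map_sum] at this
    simp only [map_smul] at this
    exact this
  obtain ⟨i, hi⟩ : S.Nonempty := Finset.card_pos.1 (by omega)
  have hcard : (S.erase i).card = k := by rw [Finset.card_erase_of_mem hi, hS]; rfl
  by_contra! hcon
  refine hSt ?_
  have hvan : ∀ j, wordProj n P (S.erase i) ⁅mackeyRankOne B f (v j), t⁆ = 0 := by
    intro j
    refine hcon _ (fun T hT => ?_) _ hcard
    rw [wordProj_lie_mackeyRankOne hP' htD hfG (hvP j)]
    -- Here T ∪ {l} has more than k + 1 elements, beyond the degree of t.
    refine Finset.sum_eq_zero fun l hl => ?_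
    rw [ht _ (by rw [Finset.card_insert_of_notMem (Finset.mem_compl.1 hl)]; omega), map_zero]
  have hrank : ∀ j, slotMap K V m n (Function.update (S.piecewise (fun _ => 1 - P) (fun _ => P)) i
      ((LinearMap.applyₗ (v j)).smulRight (c j : Module.Dual K V))) t = 0 := by
    intro j
    -- Applying φ in slot i detects `B f` there; the scalar cancels φ(`B f`) and the sign of the
    -- dual action.
    have h := congrArg (slotMap K V m n (Function.update 1 i
      (φ.smulRight (-(φ (B f))⁻¹ • (c j : Module.Dual K V))))) (hvan j)
    rw [wordProj_lie_mackeyRankOne hP' htD hfG (hvP j), map_zero, map_sum,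
      Finset.sum_eq_single i] at h
    · rw [← h, Finset.insert_erase hi, slotMap_update_wordProj, ← slotMap_mul_apply]
      refine slotMap_congr htD fun l d hd => ?_
      by_cases hl : l = i
      · subst hl
        have h1 : (1 - P) d (v j) = d (v j) := by
          rw [LinearMap.sub_apply, LinearMap.sub_apply, hvP j d hd]; exact sub_zero _
        simp only [Pi.mul_apply, Function.update_self, Finset.piecewise_eq_of_mem _ _ _ hi,
          Module.End.mul_apply, LinearMap.neg_apply, dualMap_mackeyRankOne, h1,
          LinearMap.smulRight_apply, map_neg, map_smul, LinearMap.applyₗ_apply_apply]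
        ext w
        simp only [LinearMap.smul_apply, LinearMap.neg_apply, smul_eq_mul]
        field_simp
      · simp [Function.update_of_ne hl]
    -- For l ≠ i, slot i still carries an element of P(D) ⊆ D, on which φ vanishes.
    · intro l hl hli
      rw [slotMap_update_wordProj, ← slotMap_mul_apply]
      refine slotMap_eq_zero htD i fun d hd => ?_
      have hiT : i ∉ insert l (S.erase i) := by simp [Ne.symm hli]
      simp only [Pi.mul_apply, Function.update_self, Function.update_of_ne (Ne.symm hli),
        Finset.piecewise_eq_of_notMem _ _ _ hiT, Module.End.mul_apply, LinearMap.smulRight_apply]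
      rw [show φ (P d) = 0 from hφD (hPD d hd), zero_smul]
    · simp
  -- Summing the rank one pieces over j restores 1 - P in slot i, so the S-component itself
  -- vanishes.
  rw [wordProj, slotMap_congr htD (A' := Function.update
    (S.piecewise (fun _ => 1 - P) (fun _ => P)) i
      (∑ j, (LinearMap.applyₗ (v j)).smulRight (c j : Module.Dual K V))),
    MultilinearMap.map_update_sum, LinearMap.sum_apply, Finset.sum_eq_zero fun j _ => hrank j]
  intro l d hd
  by_cases hl : l = i
  · subst hl
    rw [Function.update_self, Finset.piecewise_eq_of_mem _ _ _ hi, hc' d hd, LinearMap.sum_apply]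
    rfl
  · rw [Function.update_of_ne hl]

theorem exists_mem_wordProj_ne_zero (hVs : ¬ FiniteDimensional K Vs)
    {B : Vs →ₗ[K] Module.Dual K V} (hB : Function.Injective B)
    {P : Module.End K (Module.Dual K V)} (hP : ∀ h, P h ∈ LinearMap.range B)
    (hP' : ∀ h ∈ LinearMap.range B, P h = h)
    (N : LieSubmodule K (mackeyLieAlgebra B) (MixedTensor K V m n)) {p k : ℕ} (hpk : p ≤ k)
    {t : MixedTensor K V m n} (htN : t ∈ N)
    (ht : ∀ T : Finset (Fin m), k < T.card → wordProj n P T t = 0)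
    (hS : ∃ S : Finset (Fin m), S.card = k ∧ wordProj n P S t ≠ 0) :
    ∃ u ∈ N, (∀ T : Finset (Fin m), p < T.card → wordProj n P T u = 0) ∧
      ∃ S : Finset (Fin m), S.card = p ∧ wordProj n P S u ≠ 0 := by
  obtain ⟨k, rfl⟩ := Nat.exists_eq_add_of_le hpk
  clear hpk
  induction k generalizing t with
  | zero => exact ⟨t, htN, ht, hS⟩
  | succ k ih =>
    obtain ⟨S, hS, hSt⟩ := hS
    obtain ⟨g, hg, hg'⟩ := exists_lie_wordProj_ne_zero hVs hB hP hP' ht hS hSt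
    exact ih (N.lie_mem htN) hg hg'

theorem exists_mem_shiftedFiltration_succ (hVs : ¬ FiniteDimensional K Vs)
    {B : Vs →ₗ[K] Module.Dual K V} (hB : Function.Injective B) (p : ℕ)
    (N : LieSubmodule K (mackeyLieAlgebra B) (MixedTensor K V m n)) {t : MixedTensor K V m n}
    (htN : t ∈ N) (ht : t ∉ shiftedFiltration B m n p) :
    ∃ u ∈ N, u ∈ shiftedFiltration B m n (p + 1) ∧ u ∉ shiftedFiltration B m n p := by
  obtain ⟨P, hP, hP'⟩ := exists_projection_onto (LinearMap.range B)
  simp only [mem_shiftedFiltration_iff hP hP', not_forall] at ht ⊢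
  obtain ⟨T, hpT, hT⟩ := ht
  classical
  -- |S| is the degree of t, and it is at least p because t lies outside step p of the shifted
  -- chain.
  obtain ⟨S, hS, hmax⟩ := (Finset.univ.filter fun S : Finset (Fin m) =>
    wordProj n P S t ≠ 0).exists_max_image Finset.card ⟨T, by simpa using hT⟩
  simp only [Finset.mem_filter, Finset.mem_univ, true_and] at hS hmax
  obtain ⟨u, huN, hu, S', hS', hne⟩ := exists_mem_wordProj_ne_zero hVs hB hP hP' N
    (hpT.trans (hmax T hT)) htN
    (fun T' hT' => by_contra fun h => absurd (hmax T' h) (by omega)) ⟨S, rfl, hS⟩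
  exact ⟨u, huN, fun T hT => hu T hT, S', hS'.ge, hne⟩

theorem shiftedFiltration_monotone (B : Vs →ₗ[K] Module.Dual K V) :
    Monotone (shiftedFiltration B m n) := by
  obtain ⟨P, hP, hP'⟩ := exists_projection_onto (LinearMap.range B)
  intro a b hab t
  simp only [mem_shiftedFiltration_iff hP hP']
  exact fun h T hT => h T (hab.trans hT)

theorem shiftedFiltration_eq_top (B : Vs →ₗ[K] Module.Dual K V) :
    shiftedFiltration B m n (m + 1) = ⊤ := by
  obtain ⟨P, hP, hP'⟩ := exists_projection_onto (LinearMap.range B)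
  rw [eq_top_iff]
  intro t _
  rw [mem_shiftedFiltration_iff hP hP']
  intro T hT
  have := T.card_le_univ
  rw [Fintype.card_fin] at this
  omega

end Main

theorem proposition3p3 {V : Type*} {Vs : Type*} [AddCommGroup V] [Module ℂ V]
    [AddCommGroup Vs] [Module ℂ Vs]
    (hV : Module.rank ℂ V = Cardinal.aleph0) (hVs : Module.rank ℂ Vs = Cardinal.aleph0)
    (B : Vs →ₗ[ℂ] V →ₗ[ℂ] ℂ) (hB : B.Nondegenerate) (m n : ℕ) :
    IsEssentialFiltration (fun k : Fin (m + 1) => mixedFiltration B m n k) ∧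
    -- the filtration preceded by `W^{-1} = 0`
    IsEssentialFiltration
      (Fin.cons ⊥ (fun k : Fin (m + 1) => mixedFiltration B m n k) :
        Fin (m + 2) → LieSubmodule ℂ (mackeyLieAlgebra B) (MixedTensor ℂ V m n)) := by
  have hinf : ¬ FiniteDimensional ℂ Vs := fun h =>
    (Module.rank_lt_aleph0_iff.2 h).ne hVs
  have hinj : Function.Injective B := LinearMap.ker_eq_bot.1
    (LinearMap.separatingLeft_iff_ker_eq_bot.1 hB.1)
  have hstep := fun p N t => exists_mem_shiftedFiltration_succ (m := m) (n := n) (t := t)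
    hinf hinj p N
  constructor
  -- W^k is step k + 1 of the shifted chain, so both chains rest on the same one-step statement.
  · exact isEssentialFiltration_of_exists_mem_succ (F := fun k => mixedFiltration B m n k)
      (fun a b hab => shiftedFiltration_monotone B (Nat.succ_le_succ hab))
      (shiftedFiltration_eq_top B) (fun p => hstep (p + 1))
  · have hcons : (Fin.cons ⊥ (fun k : Fin (m + 1) => mixedFiltration B m n k) :
        Fin (m + 2) → LieSubmodule ℂ (mackeyLieAlgebra B) (MixedTensor ℂ V m n)) =
        fun k : Fin (m + 2) => shiftedFiltration B m n k := by
      funext k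
      refine Fin.cases rfl (fun k => rfl) k
    rw [hcons]
    exact isEssentialFiltration_of_exists_mem_succ (shiftedFiltration_monotone B)
      (shiftedFiltration_eq_top B) hstep
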